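/- **Theorem 2.0.** Let $B$ be a real Banach space and $\alpha\ge 0$. A nonempty closed set $P\subset B$ is called *$\alpha$-paraconvex* if for every open ball $D\subset B$ of radius $r>0$ one has $$\operatorname{dist}(q,P)\le \alpha r\qquad\text{for all } q\in \operatorname{conv}(P\cap D).$$ Let $\operatorname{bexp}_\alpha(B)$ be the set of all bounded $\alpha$-paraconvex subsets of $B$, endowed with the Hausdorff metric, and let $C_b(B,B)$ be the space of all bounded continuous maps $B\to B$, endowed with the sup-metric. Let $0\le\alpha<\tfrac12$, let $X$ be a paracompact topological space, and let $F:X\to \operatorname{bexp}_\alpha(B)$ be continuous. Then there is a continuous map $X\to C_b(B,B)$, $x\mapsto \mathfrak F_x$, such that for every $x\in X$ the map $\mathfrak F_x:B\to B$ is a continuous retraction of $B$ onto $F(x)$, that is, $\mathfrak F_x(B)\subset F(x)$ and $\mathfrak F_x(a)=a$ for all $a\in F(x)$. -/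

import Mathlib

open TopologicalSpace
open scoped BoundedContinuousFunction

/-- A set `P` in a real normed space is `α`-paraconvex: it is nonempty and closed, and for every
open ball `D` of radius `r > 0` every point `q` of the convex hull of `P ∩ D` satisfies
`dist (q, P) ≤ α * r`. -/
structure IsParaconvex {B : Type*} [NormedAddCommGroup B] [NormedSpace ℝ B]
    (α : ℝ) (P : Set B) : Prop where
  nonempty : P.Nonempty
  isClosed : IsClosed P
  infDist_le : ∀ (c : B) (r : ℝ), 0 < r →
    ∀ q ∈ convexHull ℝ (P ∩ Metric.ball c r), Metric.infDist q P ≤ α * r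

/-- The family of all bounded `α`-paraconvex subsets of `B`, as a type. -/
def BoundedParaconvex (α : ℝ) (B : Type*) [NormedAddCommGroup B] [NormedSpace ℝ B] : Type _ :=
  {P : Closeds B // IsParaconvex α (P : Set B) ∧ Bornology.IsBounded (P : Set B)}

namespace BoundedParaconvex

variable {α : ℝ} {B : Type*} [NormedAddCommGroup B] [NormedSpace ℝ B]

/-- The underlying subset of `B`. -/
def toSet (P : BoundedParaconvex α B) : Set B := (P.1 : Set B)

theorem isParaconvex (P : BoundedParaconvex α B) : IsParaconvex α P.toSet := P.2.1

theorem isBounded (P : BoundedParaconvex α B) : Bornology.IsBounded P.toSet := P.2.2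

noncomputable instance : EMetricSpace (BoundedParaconvex α B) :=
  inferInstanceAs (EMetricSpace
    {P : Closeds B // IsParaconvex α (P : Set B) ∧ Bornology.IsBounded (P : Set B)})

theorem edist_eq (P Q : BoundedParaconvex α B) :
    edist P Q = Metric.hausdorffEDist P.toSet Q.toSet := rfl

/-- The Hausdorff metric on the bounded `α`-paraconvex subsets of `B`. -/
noncomputable instance : MetricSpace (BoundedParaconvex α B) :=
  EMetricSpace.toMetricSpace fun P Q =>
    Metric.hausdorffEDist_ne_top_of_nonempty_of_bounded P.isParaconvex.nonempty
      Q.isParaconvex.nonempty P.isBounded Q.isBounded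

theorem dist_eq (P Q : BoundedParaconvex α B) :
    dist P Q = Metric.hausdorffDist P.toSet Q.toSet := rfl

end BoundedParaconvex

/-- `f` is a continuous retraction of the space `B` onto its subset `A`. -/
structure IsRetractionOnto {B : Type*} [TopologicalSpace B] (f : B → B) (A : Set B) : Prop where
  continuous : Continuous f
  mem : ∀ b, f b ∈ A
  apply_eq : ∀ a ∈ A, f a = a

open Filter Topology Metric
open scoped Pointwise

/-! Convex combinations of points of an `α`-paraconvex set in a ball of radius `r` miss the set by
at most `α * r`. For `α < 1`, alternating continuous convex selection with this estimate therefore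
shrinks errors geometrically (Michael's iteration), and the limit is a retraction onto a single set.
For families, the same iteration runs in the Banach space of bounded maps, on the sets
`uniformRetractions P`. A convex combination of retractions within `r` of a map has pointwise error
at most `α * r`, and correcting it by the first iteration costs about `α * r / (1 - α)`. So the new
contraction factor is about `α / (1 - α)`, which is below `1` exactly when `α < 1/2`. Uniform
control near `P` (`FixesNear`) makes these sets lower semicontinuous in `P`. The selection is made
on the metric space of all bounded paraconvex sets, then composed with `F`. -/

/-- Successive improvement: if every approximation in stage `n` has an improvement in stage `n + 1`
which differs from it by at most `C y * β ^ n`, then the improvements converge locally uniformly. -/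
theorem exists_continuous_limit_of_geometric_improvement {Y E : Type*} [TopologicalSpace Y]
    [MetricSpace E] [CompleteSpace E] {β : ℝ} (hβ₀ : 0 ≤ β) (hβ₁ : β < 1)
    {C : Y → ℝ} (hC : Continuous C)
    (p : ℕ → (Y → E) → Prop) (hp : ∀ n f, p n f → Continuous f)
    (step : ∀ n f, p n f → ∃ f', p (n + 1) f' ∧ ∀ y, dist (f y) (f' y) ≤ C y * β ^ n)
    {f₀ : Y → E} (h₀ : p 0 f₀) :
    ∃ (g : Y → E) (f : ℕ → Y → E), Continuous g ∧ f 0 = f₀ ∧ (∀ n, p n (f n)) ∧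
      ∀ y n, dist (f n y) (g y) ≤ C y * β ^ n / (1 - β) := by
  choose next hnext hdist using step
  let s : ∀ n : ℕ, {f : Y → E // p n f} := fun n =>
    Nat.rec ⟨f₀, h₀⟩ (fun n f => ⟨next n f.1 f.2, hnext n f.1 f.2⟩) n
  have hs : ∀ y n, dist ((s n).1 y) ((s (n + 1)).1 y) ≤ C y * β ^ n := fun y n =>
    hdist n (s n).1 (s n).2 y
  have hlim : ∀ y, ∃ a, Tendsto (fun n => (s n).1 y) atTop (𝓝 a) := fun y =>
    cauchySeq_tendsto_of_complete (cauchySeq_of_le_geometric β (C y) hβ₁ (hs y))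
  choose g hg using hlim
  have hbound : ∀ y n, dist ((s n).1 y) (g y) ≤ C y * β ^ n / (1 - β) := fun y n =>
    dist_le_of_le_geometric_of_tendsto β (C y) hβ₁ (hs y) (hg y) n
  refine ⟨g, fun n => (s n).1, ?_, rfl, fun n => (s n).2, hbound⟩
  have hloc : TendstoLocallyUniformly (fun n => (s n).1) g atTop := by
    rw [Metric.tendstoLocallyUniformly_iff]
    intro ε hε y
    -- `C` may be unbounded, so uniformity is only local.
    refine ⟨{z | C z < C y + 1}, (isOpen_lt hC continuous_const).mem_nhds (by simp), ?_⟩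
    have ht : Tendsto (fun n : ℕ => (C y + 1) * β ^ n / (1 - β)) atTop (𝓝 0) := by
      simpa using ((tendsto_pow_atTop_nhds_zero_of_lt_one hβ₀ hβ₁).const_mul (C y + 1)).div_const
        (1 - β)
    filter_upwards [ht.eventually_lt_const hε] with n hn z hz
    rw [dist_comm]
    refine (hbound z n).trans_lt (lt_of_le_of_lt ?_ hn)
    have : 0 < 1 - β := by linarith
    have hz' : C z ≤ C y + 1 := le_of_lt hz
    gcongr
  exact hloc.continuous (Frequently.of_forall fun n => hp n _ (s n).2)

/-! ### Retractions onto a single paraconvex set -/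

section Retractions

variable {B : Type*} [NormedAddCommGroup B]

/-- `g b` is close to `b` when `b` is close to `P`, uniformly. -/
def FixesNear (g : B → B) (P : Set B) : Prop :=
  ∀ ε > 0, ∃ δ > 0, ∀ b, infDist b P < δ → dist (g b) b ≤ ε

theorem FixesNear.apply_eq {g : B → B} {P : Set B} (h : FixesNear g P) {a : B} (ha : a ∈ P) :
    g a = a := by
  refine dist_le_zero.1 (le_of_forall_pos_le_add fun ε hε => ?_)
  obtain ⟨δ, hδ, H⟩ := h ε hε
  rw [zero_add]
  exact H a (by rwa [infDist_zero_of_mem ha])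

/-- The bounded retractions onto `P` which move the points near `P` uniformly little. -/
def uniformRetractions (P : Set B) : Set (B →ᵇ B) :=
  {g | (∀ b, g b ∈ P) ∧ FixesNear g P}

theorem isClosed_uniformRetractions {P : Set B} (hP : IsClosed P) :
    IsClosed (uniformRetractions P) := by
  refine isClosed_of_closure_subset fun g hg => ⟨fun b => ?_, fun ε hε => ?_⟩
  · have : IsClosed {f : B →ᵇ B | f b ∈ P} :=
      hP.preimage (by fun_prop : Continuous fun f : B →ᵇ B => f b)
    exact closure_minimal (fun f hf => hf.1 b) this hg
  · obtain ⟨f, hf, hfg⟩ := Metric.mem_closure_iff.1 hg (ε / 2) (half_pos hε)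
    obtain ⟨δ, hδ, H⟩ := hf.2 (ε / 2) (half_pos hε)
    refine ⟨δ, hδ, fun b hb => ?_⟩
    have h1 := H b hb
    have h2 := BoundedContinuousFunction.dist_coe_le_dist (f := g) (g := f) b
    linarith [dist_triangle (g b) (f b) b]

variable [NormedSpace ℝ B]

/-- Balls about `b` are convex. Averages of retractions leave `P` but keep this property, so they
can still be corrected. -/
theorem convex_setOf_fixesNear (P : Set B) : Convex ℝ {g : B →ᵇ B | FixesNear g P} := by
  intro f hf g hg s t hs ht hst ε hε
  obtain ⟨δ₁, hδ₁, H₁⟩ := hf ε hε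
  obtain ⟨δ₂, hδ₂, H₂⟩ := hg ε hε
  refine ⟨min δ₁ δ₂, lt_min hδ₁ hδ₂, fun b hb => ?_⟩
  have h1 : f b ∈ closedBall b ε := H₁ b (hb.trans_le (min_le_left _ _))
  have h2 : g b ∈ closedBall b ε := H₂ b (hb.trans_le (min_le_right _ _))
  exact convex_closedBall b ε h1 h2 hs ht hst

/-- Improvement of a map which is the identity on a paraconvex set `Q`, by a convex selection
off `Q`. -/
theorem IsParaconvex.exists_improvement {α : ℝ} {Q : Set B} (hQ : IsParaconvex α Q)
    {f : B → B} (hf : Continuous f) (hfQ : ∀ a ∈ Q, f a = a)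
    {r : B → ℝ} (hr : Continuous r) (hrQ : ∀ a ∈ Q, r a = 0) (hr₀ : ∀ b ∉ Q, 0 < r b)
    (hfr : ∀ b ∉ Q, infDist (f b) Q < r b) :
    ∃ f' : B → B, Continuous f' ∧ (∀ a ∈ Q, f' a = a) ∧ (∀ b, dist (f b) (f' b) ≤ r b) ∧
      ∀ b ∉ Q, infDist (f' b) Q ≤ α * r b := by
  classical
  -- A point `q` of `Q` in the open ball at `b` stays in the balls at nearby points, so it is a
  -- locally constant selection.
  obtain ⟨k, hk⟩ := exists_continuous_forall_mem_convex_of_local_const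
    (X := (Qᶜ : Set B)) (t := fun b => convexHull ℝ (Q ∩ ball (f b) (r b)))
    (fun b => convex_convexHull ℝ _) (by
      rintro ⟨b, hb⟩
      obtain ⟨q, hq, hbq⟩ := (infDist_lt_iff hQ.nonempty).1 (hfr b hb)
      refine ⟨q, ?_⟩
      have ho : IsOpen {y : (Qᶜ : Set B) | dist (f y) q < r y} :=
        isOpen_lt (by fun_prop) (by fun_prop)
      filter_upwards [ho.mem_nhds hbq] with y hy
      exact subset_convexHull ℝ _ ⟨hq, by rwa [mem_ball, dist_comm]⟩)
  have hkd : ∀ b : (Qᶜ : Set B), dist (f b) (k b) < r b := fun b => by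
    have := convexHull_min Set.inter_subset_right (convex_ball (f b) (r b)) (hk b)
    rwa [mem_ball, dist_comm] at this
  let f' : B → B := fun b => if h : b ∈ Q then b else k ⟨b, h⟩
  have hf'Q : ∀ a ∈ Q, f' a = a := fun a ha => dif_pos ha
  have hf'k : ∀ b (hb : b ∉ Q), f' b = k ⟨b, hb⟩ := fun b hb => dif_neg hb
  have hdist : ∀ b, dist (f b) (f' b) ≤ r b := fun b => by
    by_cases hb : b ∈ Q
    · rw [hf'Q b hb, hfQ b hb, hrQ b hb, dist_self]
    · rw [hf'k b hb]
      exact (hkd ⟨b, hb⟩).le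
  refine ⟨f', continuous_iff_continuousAt.2 fun b => ?_, hf'Q, hdist, fun b hb => ?_⟩
  · by_cases hb : b ∈ Q
    · have h1 : Tendsto (fun y => dist (f' y) (f y)) (𝓝 b) (𝓝 0) := by
        refine squeeze_zero (fun _ => dist_nonneg) (fun y => ?_) (hrQ b hb ▸ hr.tendsto b)
        rw [dist_comm]
        exact hdist y
      have h2 : Tendsto f (𝓝 b) (𝓝 (f' b)) := by
        rw [hf'Q b hb]
        simpa [hfQ b hb] using hf.tendsto b
      exact (tendsto_iff_of_dist h1).2 h2
    · have ho : IsOpen (Qᶜ : Set B) := hQ.isClosed.isOpen_compl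
      have : ContinuousOn f' Qᶜ := by
        rw [continuousOn_iff_continuous_domRestrict]
        convert k.continuous using 1
        ext y
        exact hf'k y y.2
      exact this.continuousAt (ho.mem_nhds hb)
  · rw [hf'k b hb]
    exact hQ.infDist_le _ _ (hr₀ b hb) _ (hk ⟨b, hb⟩)

variable [CompleteSpace B]

/-- A map which is nearly the identity near `Q` and takes values near `Q` is close to a uniform
retraction onto `Q`. -/
theorem IsParaconvex.exists_uniformRetraction_near {α : ℝ} {Q : Set B} (hQ : IsParaconvex α Q)
    (hQb : Bornology.IsBounded Q) {β : ℝ} (hβ₀ : 0 < β) (hαβ : α < β) (hβ₁ : β < 1)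
    (g : B →ᵇ B) (hg : FixesNear g Q) {ρ η : ℝ} (hη : 0 < η) (hρ : ∀ b, infDist (g b) Q ≤ ρ) :
    ∃ g' ∈ uniformRetractions Q, dist g' g ≤ (ρ + η) / (1 - β) := by
  have hβ : 0 < 1 - β := by linarith
  -- The `min` term makes the bound strict off `Q`, vanishes on `Q`, costs at most `η`, and is small
  -- uniformly near `Q`.
  let r : B → ℝ := fun b => infDist (g b) Q + min η (infDist b Q)
  have hr : Continuous r := ((continuous_infDist_pt Q).comp g.continuous).add
    (continuous_const.min (continuous_infDist_pt Q))
  have hmin : ∀ b, 0 ≤ min η (infDist b Q) := fun b => le_min hη.le infDist_nonneg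
  have hr₀ : ∀ b, 0 ≤ r b := fun b => add_nonneg infDist_nonneg (hmin b)
  have hrQ : ∀ a ∈ Q, r a = 0 := fun a ha => by
    simp [r, hg.apply_eq ha, infDist_zero_of_mem ha, hη.le]
  have hlt : ∀ b ∉ Q, infDist (g b) Q < r b := fun b hb =>
    lt_add_of_pos_right _ (lt_min hη ((hQ.isClosed.notMem_iff_infDist_pos hQ.nonempty).1 hb))
  have hrpos : ∀ b ∉ Q, 0 < r b := fun b hb => infDist_nonneg.trans_lt (hlt b hb)
  obtain ⟨k, f, hk, hf₀, hf, hfk⟩ := exists_continuous_limit_of_geometric_improvement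
    hβ₀.le hβ₁ hr
    (fun n f => Continuous f ∧ (∀ a ∈ Q, f a = a) ∧ ∀ b ∉ Q, infDist (f b) Q < r b * β ^ n)
    (fun n f h => h.1)
    (by
      rintro n f ⟨hf, hfQ, hfr⟩
      have hβn : 0 < β ^ n := pow_pos hβ₀ n
      obtain ⟨f', h1, h2, h3, h4⟩ := hQ.exists_improvement hf hfQ
        (r := fun b => r b * β ^ n) (hr.mul continuous_const)
        (fun a ha => by simp [hrQ a ha]) (fun b hb => mul_pos (hrpos b hb) hβn) hfr
      refine ⟨f', ⟨h1, h2, fun b hb => (h4 b hb).trans_lt ?_⟩, h3⟩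
      have := mul_lt_mul_of_pos_right hαβ (mul_pos (hrpos b hb) hβn)
      rw [pow_succ]
      linarith)
    (f₀ := g) ⟨g.continuous, fun a ha => hg.apply_eq ha, fun b hb => by simpa using hlt b hb⟩
  have hgk : ∀ b, dist (g b) (k b) ≤ r b / (1 - β) := fun b => by
    have := hfk b 0
    rwa [hf₀, pow_zero, mul_one] at this
  have hkQ : ∀ b, k b ∈ Q := fun b => by
    by_cases hb : b ∈ Q
    · have h0 := hgk b
      rw [hrQ b hb, zero_div, hg.apply_eq hb] at h0
      rwa [← dist_le_zero.1 h0]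
    rw [hQ.isClosed.mem_iff_infDist_zero hQ.nonempty]
    refine le_antisymm ?_ infDist_nonneg
    have ht : Tendsto (fun n : ℕ => r b * β ^ n + r b * β ^ n / (1 - β)) atTop (𝓝 0) := by
      have h1 := (tendsto_pow_atTop_nhds_zero_of_lt_one hβ₀.le hβ₁).const_mul (r b)
      simpa using h1.add (h1.div_const (1 - β))
    refine ge_of_tendsto' ht fun n => ?_
    have h1 := (hf n).2.2 b hb
    have h2 := hfk b n
    have h3 : infDist (k b) Q ≤ infDist (f n b) Q + dist (k b) (f n b) :=
      infDist_le_infDist_add_dist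
    rw [dist_comm] at h3
    linarith
  obtain ⟨C, hC⟩ := isBounded_iff.1 hQb
  let g' : B →ᵇ B := BoundedContinuousFunction.mkOfBound ⟨k, hk⟩ C
    fun x y => hC (hkQ x) (hkQ y)
  refine ⟨g', ⟨hkQ, fun ε hε => ?_⟩, ?_⟩
  · have hc : 0 < 1 + 1 / (1 - β) + 1 / (1 - β) * 2 := by positivity
    obtain ⟨δ, hδ, H⟩ := hg (ε / (1 + 1 / (1 - β) + 1 / (1 - β) * 2)) (div_pos hε hc)
    set ε' := ε / (1 + 1 / (1 - β) + 1 / (1 - β) * 2) with hε'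
    have hεε : ε' * (1 + 1 / (1 - β) + 1 / (1 - β) * 2) = ε := div_mul_cancel₀ _ hc.ne'
    refine ⟨min δ ε', lt_min hδ (div_pos hε hc), fun b hb => ?_⟩
    have h1 := H b (hb.trans_le (min_le_left _ _))
    have h2 := hb.trans_le (min_le_right _ _)
    have h3 : infDist (g b) Q ≤ infDist b Q + dist (g b) b := infDist_le_infDist_add_dist
    have h4 : r b ≤ ε' * 3 := by
      have := min_le_right η (infDist b Q)
      simp only [r]
      linarith
    have h5 : r b / (1 - β) ≤ ε' * 3 / (1 - β) := by gcongr
    calc dist (k b) b ≤ dist (k b) (g b) + dist (g b) b := dist_triangle _ _ _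
      _ ≤ ε' * 3 / (1 - β) + ε' := add_le_add (dist_comm (g b) (k b) ▸ (hgk b).trans h5) h1
      _ = ε := by rw [← hεε]; ring
  · have hρ₀ : 0 ≤ ρ := infDist_nonneg.trans (hρ 0)
    rw [BoundedContinuousFunction.dist_le (by positivity)]
    intro b
    rw [dist_comm]
    refine (hgk b).trans ?_
    have := min_le_left η (infDist b Q)
    have := hρ b
    have : r b ≤ ρ + η := by
      simp only [r]
      linarith
    gcongr

/-- A bounded map which takes values near `Q` and moves the points near `Q` by at most `K` is close
to a uniform retraction onto `Q`. -/
theorem IsParaconvex.exists_uniformRetraction_of_dist_le {α : ℝ} {Q : Set B}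
    (hQ : IsParaconvex α Q) (hQb : Bornology.IsBounded Q) {β : ℝ} (hβ₀ : 0 < β) (hαβ : α < β)
    (hβ₁ : β < 1) (g : B →ᵇ B) {δ K ρ η : ℝ} (hδ : 0 < δ) (hK : 0 ≤ K) (hη : 0 < η)
    (hgK : ∀ b, infDist b Q < δ → dist (g b) b ≤ K) (hρ : ∀ b, infDist (g b) Q ≤ ρ) :
    ∃ g' ∈ uniformRetractions Q, dist g' g ≤ K + (ρ + K + η) / (1 - β) := by
  -- The cutoff is `1` on `Q` and `0` at distance at least `δ`; it blends `g` into the identity near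
  -- `Q`, moving values by at most `K`.
  let s : B → ℝ := fun b => max 0 (1 - infDist b Q / δ)
  have hs : Continuous s := continuous_const.max
    (continuous_const.sub ((continuous_infDist_pt Q).div_const δ))
  have hs₀ : ∀ b, 0 ≤ s b := fun b => le_max_left _ _
  have hs₁ : ∀ b, s b ≤ 1 := fun b =>
    max_le zero_le_one (sub_le_self _ (div_nonneg infDist_nonneg hδ.le))
  let k : B → B := fun b => g b + s b • (b - g b)
  have hk : Continuous k := g.continuous.add (hs.smul (continuous_id.sub g.continuous))
  have hkg : ∀ b, dist (k b) (g b) ≤ K := fun b => by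
    have he : dist (k b) (g b) = s b * dist (g b) b := by
      rw [dist_eq_norm, dist_comm, dist_eq_norm b]
      simp [k, norm_smul, abs_of_nonneg (hs₀ b)]
    rw [he]
    by_cases hb : infDist b Q < δ
    · exact (mul_le_of_le_one_left dist_nonneg (hs₁ b)).trans (hgK b hb)
    · have : s b = 0 := max_eq_left (by
        rw [sub_nonpos, one_le_div hδ]
        exact not_lt.1 hb)
      rwa [this, zero_mul]
  obtain ⟨C, hC⟩ := g.bounded
  let k' : B →ᵇ B := BoundedContinuousFunction.mkOfBound ⟨k, hk⟩ (K + C + K) fun x y => by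
    have h1 := hkg x
    have h2 := hkg y
    have h3 := hC x y
    have h4 := dist_triangle4 (k x) (g x) (g y) (k y)
    rw [dist_comm (g y)] at h4
    exact h4.trans (by linarith)
  have hk' : FixesNear k' Q := fun ε hε => by
    refine ⟨min δ (δ * ε / (K + 1)), lt_min hδ (by positivity), fun b hb => ?_⟩
    have h1 := hb.trans_le (min_le_left _ _)
    have h2 := hb.trans_le (min_le_right _ _)
    have hd := hgK b h1
    have hsb : 1 - s b ≤ infDist b Q / δ := by
      linarith [le_max_right 0 (1 - infDist b Q / δ)]
    have he : dist (k b) b = (1 - s b) * dist (g b) b := by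
      rw [dist_eq_norm, dist_eq_norm]
      have : k b - b = (1 - s b) • (g b - b) := by
        simp only [k]
        module
      rw [this, norm_smul, Real.norm_of_nonneg (by linarith [hs₁ b])]
    change dist (k b) b ≤ ε
    rw [he]
    have h3 : infDist b Q / δ ≤ ε / (K + 1) := by
      rw [div_le_iff₀ hδ]
      exact h2.le.trans (le_of_eq (by ring))
    calc (1 - s b) * dist (g b) b ≤ ε / (K + 1) * (K + 1) :=
          mul_le_mul (hsb.trans h3) (by linarith) dist_nonneg (by positivity)
      _ = ε := div_mul_cancel₀ _ (by positivity)
  obtain ⟨g', hg', hd⟩ := hQ.exists_uniformRetraction_near hQb hβ₀ hαβ hβ₁ k' hk' hη (ρ := ρ + K)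
    (fun b => infDist_le_infDist_add_dist.trans (add_le_add (hρ b) (hkg b)))
  refine ⟨g', hg', (dist_triangle g' k' g).trans ?_⟩
  have : dist k' g ≤ K := (BoundedContinuousFunction.dist_le hK).2 hkg
  linarith

/-- The zero map suffices as a start: it moves points within `1` of the bounded set `Q` by at most
`C + 1`. -/
theorem IsParaconvex.uniformRetractions_nonempty {α : ℝ} {Q : Set B} (hQ : IsParaconvex α Q)
    (hQb : Bornology.IsBounded Q) (hα₀ : 0 ≤ α) (hα : α < 1) : (uniformRetractions Q).Nonempty := by
  obtain ⟨β, hαβ, hβ₁⟩ := exists_between hα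
  obtain ⟨C, hC⟩ := hQb.exists_norm_le
  obtain ⟨q, hq⟩ := hQ.nonempty
  have hC₀ : 0 ≤ C := (norm_nonneg q).trans (hC q hq)
  obtain ⟨g', hg', -⟩ := hQ.exists_uniformRetraction_of_dist_le hQb (hα₀.trans_lt hαβ) hαβ hβ₁
    (0 : B →ᵇ B) (δ := 1) (K := C + 1) (ρ := C) one_pos (by linarith) one_pos
    (fun b hb => by
      obtain ⟨a, ha, hba⟩ := (infDist_lt_iff hQ.nonempty).1 hb
      have := dist_triangle (0 : B) a b
      rw [dist_zero_left a, dist_comm a] at this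
      have := hC a ha
      simp only [BoundedContinuousFunction.coe_zero, Pi.zero_apply]
      linarith)
    (fun b => (infDist_le_dist_of_mem hq).trans (by simpa using hC q hq))
  exact ⟨g', hg'⟩

end Retractions

/-! ### Continuous dependence on the set -/

namespace BoundedParaconvex

variable {α : ℝ} {B : Type*} [NormedAddCommGroup B] [NormedSpace ℝ B]

theorem infDist_le_add_dist (P Q : BoundedParaconvex α B) (b : B) :
    infDist b P.toSet ≤ infDist b Q.toSet + dist Q P :=
  infDist_le_infDist_add_hausdorffDist (hausdorffEDist_ne_top_of_nonempty_of_bounded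
    Q.isParaconvex.nonempty P.isParaconvex.nonempty Q.isBounded P.isBounded)

/-- A one-point set, as a bounded paraconvex set. -/
def point (hα : 0 ≤ α) (b : B) : BoundedParaconvex α B :=
  ⟨⟨{b}, isClosed_singleton⟩, ⟨Set.singleton_nonempty b, isClosed_singleton, fun c r hr q hq => by
    have hq' : q ∈ ({b} : Set B) :=
      convexHull_min Set.inter_subset_left (convex_singleton b) hq
    change infDist q {b} ≤ α * r
    rw [infDist_zero_of_mem hq']
    positivity⟩, Bornology.isBounded_singleton⟩

variable [CompleteSpace B]

/-- The family of uniform retractions depends lower semicontinuously on the set. -/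
theorem eventually_exists_uniformRetraction (hα₀ : 0 ≤ α) (hα : α < 1)
    (P : BoundedParaconvex α B) {g : B →ᵇ B} (hg : g ∈ uniformRetractions P.toSet)
    {ε : ℝ} (hε : 0 < ε) :
    ∀ᶠ Q : BoundedParaconvex α B in 𝓝 P, ∃ g' ∈ uniformRetractions Q.toSet, dist g' g < ε := by
  obtain ⟨β, hαβ, hβ₁⟩ := exists_between hα
  have hβ : 0 < 1 - β := by linarith
  -- With `K = ρ = η = κ`, the correction costs `κ + 3 * κ / (1 - β)`.
  have hc : 0 < 1 + 3 / (1 - β) := by positivity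
  obtain ⟨κ, hκ₀, hκ⟩ := exists_between (div_pos hε hc)
  rw [lt_div_iff₀ hc] at hκ
  obtain ⟨δ, hδ, H⟩ := hg.2 κ hκ₀
  filter_upwards [ball_mem_nhds P (lt_min (half_pos hδ) hκ₀)] with Q hQ
  have h1 : dist Q P < δ / 2 := (mem_ball.1 hQ).trans_le (min_le_left _ _)
  have h2 : dist P Q < κ := (mem_ball'.1 hQ).trans_le (min_le_right _ _)
  obtain ⟨g', hg', hd⟩ := Q.isParaconvex.exists_uniformRetraction_of_dist_le Q.isBounded
    (hα₀.trans_lt hαβ) hαβ hβ₁ g (half_pos hδ) hκ₀.le hκ₀ (ρ := κ)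
    (fun b hb => H b (by linarith [infDist_le_add_dist P Q b]))
    (fun b => by
      have := infDist_le_add_dist Q P (g b)
      rw [infDist_zero_of_mem (hg.1 b)] at this
      linarith)
  refine ⟨g', hg', hd.trans_lt (lt_of_eq_of_lt ?_ hκ)⟩
  ring

/-- Improvement of an approximate selection of the families of uniform retractions. -/
theorem exists_improvement {β : ℝ} (hα₀ : 0 ≤ α) (hαβ : α < β) (hβ₁ : β < 1) {ε : ℝ} (hε : 0 < ε)
    {h : BoundedParaconvex α B → (B →ᵇ B)} (hh : Continuous h)
    {r : BoundedParaconvex α B → ℝ} (hr : Continuous r) (hr₀ : ∀ P, 0 < r P)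
    (hhr : ∀ P, ∃ g ∈ uniformRetractions P.toSet, dist g (h P) < r P) :
    ∃ h' : BoundedParaconvex α B → (B →ᵇ B), Continuous h' ∧
      (∀ P, dist (h P) (h' P) ≤ (1 + ε) * r P) ∧
      ∀ P, ∃ g ∈ uniformRetractions P.toSet, dist g (h' P) < (β / (1 - β) + ε) * r P := by
  have hβ : 0 < 1 - β := by linarith
  let S : BoundedParaconvex α B → Set (B →ᵇ B) := fun P =>
    uniformRetractions P.toSet ∩ ball (h P) (r P)
  -- Nearby sets have retractions near `g`, not `g` itself; thickening by a small ball makes `g` a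
  -- locally constant selection.
  obtain ⟨k, hk⟩ := exists_continuous_forall_mem_convex_of_local_const
    (t := fun P => convexHull ℝ (S P) + ball 0 (ε * r P))
    (fun P => (convex_convexHull ℝ _).add (convex_ball _ _)) (by
      intro P
      obtain ⟨g, hg, hgr⟩ := hhr P
      obtain ⟨κ, hκ₀, hκ⟩ := exists_between
        (lt_min (sub_pos.2 hgr) (mul_pos hε (hr₀ P)))
      have h1 : dist g (h P) + κ < r P := by linarith [hκ.trans_le (min_le_left _ _)]
      have h2 : κ < ε * r P := hκ.trans_le (min_le_right _ _)
      refine ⟨g, ?_⟩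
      filter_upwards [P.eventually_exists_uniformRetraction hα₀ (hαβ.trans hβ₁) hg hκ₀,
        (isOpen_lt (by fun_prop : Continuous fun Q => dist g (h Q) + κ) hr).mem_nhds h1,
        (isOpen_lt (continuous_const (y := κ)) (hr.const_mul ε)).mem_nhds h2] with Q h3 h4 h5
      obtain ⟨g', hg', hd⟩ := h3
      refine ⟨g', subset_convexHull ℝ _ ⟨hg', ?_⟩, g - g', ?_, add_sub_cancel _ _⟩
      · have h4' : dist g (h Q) + κ < r Q := h4
        rw [mem_ball]
        linarith [dist_triangle g' g (h Q)]
      · rw [mem_ball_zero_iff, ← dist_eq_norm, dist_comm]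
        exact hd.trans h5)
  choose u hu v hv huv using hk
  have hku : ∀ P, dist (k P) (u P) < ε * r P := fun P => by
    have := hv P
    rw [mem_ball_zero_iff] at this
    rwa [← huv P, dist_eq_norm, add_sub_cancel_left]
  refine ⟨k, k.continuous, fun P => ?_, fun P => ?_⟩
  · have h1 : dist (u P) (h P) < r P :=
      convexHull_min Set.inter_subset_right (convex_ball _ _) (hu P)
    rw [dist_comm]
    linarith [dist_triangle (k P) (u P) (h P), hku P]
  · have h1 : FixesNear (u P) P.toSet :=
      convexHull_min (fun f hf => hf.1.2) (convex_setOf_fixesNear P.toSet) (hu P)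
    -- Evaluation at `b` is linear, so paraconvexity of `P` applies pointwise.
    have h2 : ∀ b, u P b ∈ convexHull ℝ (P.toSet ∩ ball (h P b) (r P)) := fun b => by
      have hconv : Convex ℝ {f : B →ᵇ B | f b ∈ convexHull ℝ (P.toSet ∩ ball (h P b) (r P))} :=
        fun f hf g hg s t hs ht hst => convex_convexHull ℝ _ hf hg hs ht hst
      refine convexHull_min (fun f hf => ?_) hconv (hu P)
      exact subset_convexHull ℝ _ ⟨hf.1.1 b,
        (BoundedContinuousFunction.dist_coe_le_dist b).trans_lt hf.2⟩
    obtain ⟨g, hg, hd⟩ := P.isParaconvex.exists_uniformRetraction_near P.isBounded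
      (hα₀.trans_lt hαβ) hαβ hβ₁ (u P) h1 (ρ := α * r P) (η := (β - α) * r P)
      (mul_pos (by linarith) (hr₀ P))
      (fun b => P.isParaconvex.infDist_le _ _ (hr₀ P) _ (h2 b))
    refine ⟨g, hg, ?_⟩
    have h3 : (α * r P + (β - α) * r P) / (1 - β) = β / (1 - β) * r P := by ring
    rw [h3] at hd
    have h4 := hku P
    rw [dist_comm] at h4
    linarith [dist_triangle g (u P) (k P)]

/-- A continuous choice of uniform retractions onto bounded paraconvex sets. -/
theorem exists_continuous_uniformRetraction (hα₀ : 0 ≤ α) (hα : α < 1 / 2) :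
    ∃ R : BoundedParaconvex α B → (B →ᵇ B),
      Continuous R ∧ ∀ P, R P ∈ uniformRetractions P.toSet := by
  obtain ⟨β, hαβ, hβ⟩ := exists_between hα
  have hβ₀ : 0 < β := hα₀.trans_lt hαβ
  have hβ' : 0 < 1 - β := by linarith
  have hq : β / (1 - β) < 1 := by
    rw [div_lt_one hβ']
    linarith
  obtain ⟨θ, hθ, hθ₁⟩ := exists_between hq
  have hθ₀ : 0 < θ := (div_pos hβ₀ hβ').trans hθ
  -- Maps into `P` have norm at most `dist P {0}`, so the zero map starts the iteration; the `1`
  -- gives strictness.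
  let r : BoundedParaconvex α B → ℝ := fun P => dist P (point hα₀ 0) + 1
  have hr : Continuous r := by fun_prop
  have hr₀ : ∀ P, 0 < r P := fun P => by positivity
  -- Chosen so that the improvement factor `β / (1 - β) + ε` equals `θ`.
  let ε := θ - β / (1 - β)
  obtain ⟨R, f, hR, -, hf, hfR⟩ := exists_continuous_limit_of_geometric_improvement
    hθ₀.le hθ₁ (C := fun P => (1 + ε) * r P) (hr.const_mul _)
    (fun n h => Continuous h ∧
      ∀ P : BoundedParaconvex α B, ∃ g ∈ uniformRetractions P.toSet, dist g (h P) < r P * θ ^ n)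
    (fun n h hh => hh.1)
    (by
      rintro n h ⟨hh, hhr⟩
      obtain ⟨h', h1, h2, h3⟩ := exists_improvement hα₀ hαβ (by linarith)
        (sub_pos.2 hθ : 0 < ε) hh (r := fun P => r P * θ ^ n) (hr.mul continuous_const)
        (fun P => mul_pos (hr₀ P) (pow_pos hθ₀ n)) hhr
      refine ⟨h', ⟨h1, fun P => ?_⟩, fun P => (h2 P).trans_eq (by ring)⟩
      obtain ⟨g, hg, hd⟩ := h3 P
      exact ⟨g, hg, hd.trans_eq (by ring)⟩)
    (f₀ := fun _ => 0) ⟨continuous_const, fun P => by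
      obtain ⟨g, hg⟩ := P.isParaconvex.uniformRetractions_nonempty P.isBounded hα₀ (by linarith)
      refine ⟨g, hg, ?_⟩
      rw [pow_zero, mul_one]
      refine lt_of_le_of_lt ?_ (lt_add_one (dist P (point hα₀ 0)))
      rw [BoundedContinuousFunction.dist_le dist_nonneg]
      intro b
      have := infDist_le_add_dist (point hα₀ 0) P (g b)
      rw [infDist_zero_of_mem (hg.1 b), zero_add] at this
      change infDist (g b) {0} ≤ _ at this
      rwa [infDist_singleton] at this⟩
  refine ⟨R, hR, fun P => ?_⟩
  rw [← (isClosed_uniformRetractions P.isParaconvex.isClosed).closure_eq, Metric.mem_closure_iff]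
  intro κ hκ
  have ht : Tendsto (fun n : ℕ => r P * θ ^ n + (1 + ε) * r P * θ ^ n / (1 - θ)) atTop (𝓝 0) := by
    have h1 := tendsto_pow_atTop_nhds_zero_of_lt_one hθ₀.le hθ₁
    simpa using (h1.const_mul (r P)).add ((h1.const_mul ((1 + ε) * r P)).div_const (1 - θ))
  obtain ⟨n, hn⟩ := (ht.eventually_lt_const hκ).exists
  obtain ⟨g, hg, hd⟩ := (hf n).2 P
  refine ⟨g, hg, ?_⟩
  have h1 := hfR P n
  rw [dist_comm]
  linarith [dist_triangle g (f n P) (R P)]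

end BoundedParaconvex

theorem theorem2p0 {X B : Type*} [TopologicalSpace X] [ParacompactSpace X]
    [NormedAddCommGroup B] [NormedSpace ℝ B] [CompleteSpace B]
    (α : ℝ) (hα₀ : 0 ≤ α) (hα : α < 1 / 2)
    (F : X → BoundedParaconvex α B) (hF : Continuous F) :
    ∃ 𝔉 : X → (B →ᵇ B), Continuous 𝔉 ∧ ∀ x : X, IsRetractionOnto (𝔉 x) (F x).toSet := by
  obtain ⟨R, hR, h⟩ := BoundedParaconvex.exists_continuous_uniformRetraction (B := B) hα₀ hα
  exact ⟨fun x => R (F x), hR.comp hF, fun x =>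
    ⟨(R (F x)).continuous, (h (F x)).1, fun a ha => (h (F x)).2.apply_eq ha⟩⟩
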